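/- Let $k$ parties share a density matrix $\rho$ on $H_1\otimes\cdots\otimes H_k$, $H_i=\mathbb{C}^{d_i}$. An entanglement witness (with respect to the fully separable states) is a Hermitian operator $W$ with $\langle\psi|W|\psi\rangle\ge 0$ for all product vectors $\psi=\psi_1\otimes\cdots\otimes\psi_k$. It is called decomposable if $W=P+\sum_{S}Q_S^{T_S}$ with $P\ge 0$ and all $Q_S\ge 0$, where $S$ runs over the groups $S\subseteq\{1,\dots,k\}$ of parties and $T_S$ is the partial transposition with respect to the parties in $S$; it is called decomposable with respect to single parties if only the groups $S=\{i\}$, $1\le i\le k$, are used. For real $n$ put $$(E^{PPT}_{n:1})^1(\rho)=\max\{0,-\min_{W}\mathrm{Tr}(W\rho)\},$$ where $W$ runs over the decomposable witnesses with $-nI\le W\le I$, and let $(E^{PPT,\mathrm{single}}_{n:1})^1(\rho)$ be the same quantity with $W$ restricted to witnesses decomposable with respect to single parties. Split the parties into two nonempty groups $S$ and $S^c$ (for instance $S=\{1,\dots,m\}$, $S^c=\{m+1,\dots,k\}$, with $1\le m<k$, or the other way round), let $\rho^{S:S^c}$ be $\rho$ regarded as a bipartite state of the two groups, and let $D=\min\{\prod_{i\in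 S}d_i,\prod_{i\notin S}d_i\}$ be the smaller of the dimensions of the groups. The teleportation distance of a channel $\Lambda$ on $\mathbb{C}^D$ is $d(\Lambda)=\int d\phi\,\|\phi-\Lambda(\phi)\|_1$, where $\phi$ is distributed uniformly over the pure states of $\mathbb{C}^D$ and $\|\cdot\|_1$ is the trace norm. The minimal teleportation distance $d_{min}(\rho^{S:S^c})$ is the infimum of $d(\Lambda)$ over all channels $\Lambda$ that transmit a $D$-dimensional system from the group $S$ to the group $S^c$ by a trace-preserving LOCC protocol between the two groups that uses one copy of $\rho^{S:S^c}$. Then, for every $n\ge D$, $$d_{min}(\rho^{S:S^c})\ \ge\ \frac{2D}{D+1}\left(1-\frac{1+(E^{PPT}_{n:1})^1(\rho)}{D}\right).$$ If one of the two groups consists of a single party, then also $$d_{min}(\rho^{S:S^c})\ \ge\ \frac{2D}{D+1}\left(1-\frac{1+(E^{PPT,\mathrm{single}}_{n:1})^1(\rho)}{D}\right).$$ -/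

import Mathlib

open scoped Matrix Kronecker ComplexOrder

noncomputable section

namespace WitnessedEntanglement

/-! ### Parties, states, witnesses -/

/-- Index set of the product basis of `H₁ ⊗ ⋯ ⊗ H_k`, where `H_i = ℂ^{d i}`. -/
abbrev Basis {k : ℕ} (d : Fin k → ℕ) : Type := ∀ i : Fin k, Fin (d i)

/-- Operators on `H₁ ⊗ ⋯ ⊗ H_k`. -/
abbrev Op {k : ℕ} (d : Fin k → ℕ) : Type := Matrix (Basis d) (Basis d) ℂ

/-- Density matrices: positive semidefinite with unit trace. -/
structure IsState {X : Type} [Fintype X] (ρ : Matrix X X ℂ) : Prop where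
  posSemidef : ρ.PosSemidef
  trace_eq_one : ρ.trace = 1

variable {k : ℕ} {d : Fin k → ℕ}

/-- The product vector `ψ₁ ⊗ ⋯ ⊗ ψ_k`. -/
def productVector (ψ : ∀ i : Fin k, Fin (d i) → ℂ) : Basis d → ℂ := fun x => ∏ i, ψ i (x i)

/-- Entanglement witnesses with respect to the fully separable (1-separable) states: Hermitian
operators with nonnegative expectation value on all product vectors. -/
def IsWitness (W : Op d) : Prop :=
  W.IsHermitian ∧ ∀ ψ : ∀ i : Fin k, Fin (d i) → ℂ,
    0 ≤ (star (productVector ψ) ⬝ᵥ (W *ᵥ productVector ψ)).re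

/-- Partial transposition `T_S` with respect to the group `S` of parties. -/
def partialTranspose (S : Finset (Fin k)) (Q : Op d) : Op d :=
  Matrix.of fun x y =>
    Q (fun i => if i ∈ S then y i else x i) (fun i => if i ∈ S then x i else y i)

/-- Decomposable operators `W = P + ∑_{S ∈ 𝒞} Q_S^{T_S}` with `P, Q_S ≥ 0`, where the partial
transpositions are taken with respect to the groups of parties in the collection `𝒞`. -/
def IsDecomposable (𝒞 : Finset (Finset (Fin k))) (W : Op d) : Prop :=
  ∃ (P : Op d) (Q : Finset (Fin k) → Op d), P.PosSemidef ∧ (∀ S, (Q S).PosSemidef) ∧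
    W = P + ∑ S ∈ 𝒞, partialTranspose S (Q S)

/-- All groups of parties (the groups `∅` and "all parties" only contribute
positive semidefinite operators). -/
def allGroups (k : ℕ) : Finset (Finset (Fin k)) := Finset.univ

/-- The groups that consist of a single party. -/
def singleParties (k : ℕ) : Finset (Finset (Fin k)) :=
  (Finset.univ : Finset (Fin k)).image fun i => {i}

/-- The feasible set `ℳ`: fully-separable witnesses `W`, decomposable with respect to the groups
in `𝒞`, with `-n I ≤ W ≤ m I`. -/
def feasible (d : Fin k → ℕ) (𝒞 : Finset (Finset (Fin k))) (n m : ℝ) : Set (Op d) :=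
  {W | IsWitness W ∧ IsDecomposable 𝒞 W ∧
    (W + (n : ℂ) • (1 : Op d)).PosSemidef ∧ ((m : ℂ) • (1 : Op d) - W).PosSemidef}

/-- The witnessed entanglement `(E^{PPT}_{n:m})¹(ρ) = max {0, - min_{W ∈ ℳ} Tr(W ρ)}`. -/
def witnessedPPT (𝒞 : Finset (Finset (Fin k))) (n m : ℝ) (ρ : Op d) : ℝ :=
  max 0 (-sInf ((fun W : Op d => (W * ρ).trace.re) '' feasible d 𝒞 n m))

/-! ### Splitting the parties into two groups -/

/-- Basis of the group formed by the parties in `S`. -/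
abbrev GroupIn (d : Fin k → ℕ) (S : Finset (Fin k)) : Type := ∀ i : {i // i ∈ S}, Fin (d i)

/-- Basis of the group formed by the parties not in `S`. -/
abbrev GroupOut (d : Fin k → ℕ) (S : Finset (Fin k)) : Type := ∀ i : {i // i ∉ S}, Fin (d i)

/-- The `k`-partite state `ρ` seen as a bipartite state of the groups `S` and `Sᶜ`. -/
def split (S : Finset (Fin k)) (ρ : Op d) :
    Matrix (GroupIn d S × GroupOut d S) (GroupIn d S × GroupOut d S) ℂ :=
  ρ.submatrix (Equiv.piEquivPiSubtypeProd (· ∈ S) fun i => Fin (d i)).symm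
    (Equiv.piEquivPiSubtypeProd (· ∈ S) fun i => Fin (d i)).symm

/-- The smaller of the dimensions of the groups `S` and `Sᶜ`. -/
def splitDim (d : Fin k → ℕ) (S : Finset (Fin k)) : ℕ := min (∏ i ∈ S, d i) (∏ i ∈ Sᶜ, d i)

/-! ### LOCC protocols -/

/-- `IsLOCC α β Φ`: the map `Φ`, from operators on `ℂ^α ⊗ ℂ^β` to operators on `ℂ^γ ⊗ ℂ^δ`, is
implemented by a (trace preserving) LOCC protocol with finitely many rounds between Alice (first
factor) and Bob (second factor). In each round one of them performs a complete local measurement,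
given by Kraus operators `K i` with `∑ i, (K i)ᴴ * K i = 1` and possibly new output spaces, and
communicates the outcome `i`; the rest of the protocol may depend on it. -/
inductive IsLOCC {γ δ : Type} [Fintype γ] [DecidableEq γ] [Fintype δ] [DecidableEq δ] :
    ∀ (α β : Type) [Fintype α] [DecidableEq α] [Fintype β] [DecidableEq β],
      (Matrix (α × β) (α × β) ℂ → Matrix (γ × δ) (γ × δ) ℂ) → Prop
  | done : IsLOCC γ δ fun X => X
  | alice (α β : Type) [Fintype α] [DecidableEq α] [Fintype β] [DecidableEq β]
      (ι : Type) [Fintype ι] (α' : ι → Type) [∀ i, Fintype (α' i)] [∀ i, DecidableEq (α' i)]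
      (K : ∀ i, Matrix (α' i) α ℂ) (hK : ∑ i, (K i)ᴴ * K i = 1)
      (Φ : ∀ i, Matrix (α' i × β) (α' i × β) ℂ → Matrix (γ × δ) (γ × δ) ℂ)
      (hΦ : ∀ i, IsLOCC (α' i) β (Φ i)) :
      IsLOCC α β fun X =>
        ∑ i, Φ i ((K i ⊗ₖ (1 : Matrix β β ℂ)) * X * (K i ⊗ₖ (1 : Matrix β β ℂ))ᴴ)
  | bob (α β : Type) [Fintype α] [DecidableEq α] [Fintype β] [DecidableEq β]
      (ι : Type) [Fintype ι] (β' : ι → Type) [∀ i, Fintype (β' i)] [∀ i, DecidableEq (β' i)]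
      (K : ∀ i, Matrix (β' i) β ℂ) (hK : ∑ i, (K i)ᴴ * K i = 1)
      (Φ : ∀ i, Matrix (α × β' i) (α × β' i) ℂ → Matrix (γ × δ) (γ × δ) ℂ)
      (hΦ : ∀ i, IsLOCC α (β' i) (Φ i)) :
      IsLOCC α β fun X =>
        ∑ i, Φ i (((1 : Matrix α α ℂ) ⊗ₖ K i) * X * ((1 : Matrix α α ℂ) ⊗ₖ K i)ᴴ)

/-! ### Teleportation -/

/-- The trace norm `‖A‖₁ = Tr √(A† A)`, i.e. the sum of the singular values of `A`. -/
def traceNorm {X : Type} [Fintype X] [DecidableEq X] (A : Matrix X X ℂ) : ℝ :=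
  ∑ i, Real.sqrt ((Matrix.isHermitian_conjTranspose_mul_self A).eigenvalues i)

/-- The projector `|φ⟩⟨φ|` onto a unit vector `φ ∈ ℂ^D`. -/
def pureState {D : ℕ} (φ : Metric.sphere (0 : EuclideanSpace ℂ (Fin D)) 1) :
    Matrix (Fin D) (Fin D) ℂ :=
  Matrix.of fun i j => φ.1 i * star (φ.1 j)

/-- The teleportation distance `d(Λ) = ∫ dφ ‖φ - Λ(φ)‖₁`, where `dφ` is the uniform probability
measure on the pure states of `ℂ^D` (the normalized surface measure of the unit sphere). -/
def teleportationDistance {D : ℕ} (Λ : Matrix (Fin D) (Fin D) ℂ → Matrix (Fin D) (Fin D) ℂ) : ℝ :=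
  ⨍ φ, traceNorm (pureState φ - Λ (pureState φ))
    ∂(MeasureTheory.volume : MeasureTheory.Measure (EuclideanSpace ℂ (Fin D))).toSphere

/-- The channel obtained from a bipartite resource state `σ` and a protocol `Φ`: Alice holds the
`D`-dimensional input and the first half of `σ`, Bob holds the second half of `σ`; after the
protocol Bob holds the `D`-dimensional output, and Alice's (trivial) system is dropped. -/
def teleportChannel {D : ℕ} {A B : Type} (σ : Matrix (A × B) (A × B) ℂ)
    (Φ : Matrix ((Fin D × A) × B) ((Fin D × A) × B) ℂ →
      Matrix (Unit × Fin D) (Unit × Fin D) ℂ)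
    (X : Matrix (Fin D) (Fin D) ℂ) : Matrix (Fin D) (Fin D) ℂ :=
  Matrix.of fun i j =>
    Φ (Matrix.of fun x y => X x.1.1 y.1.1 * σ (x.1.2, x.2) (y.1.2, y.2)) ((), i) ((), j)

/-- The minimal teleportation distance `d_min(σ)` for teleporting a `D`-dimensional system from
Alice to Bob by LOCC with the bipartite resource state `σ`. -/
def minTeleportationDistance (D : ℕ) {A B : Type} [Fintype A] [DecidableEq A]
    [Fintype B] [DecidableEq B] (σ : Matrix (A × B) (A × B) ℂ) : ℝ :=
  sInf {t | ∃ Φ : Matrix ((Fin D × A) × B) ((Fin D × A) × B) ℂ →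
      Matrix (Unit × Fin D) (Unit × Fin D) ℂ,
    IsLOCC (Fin D × A) B Φ ∧ t = teleportationDistance (teleportChannel σ Φ)}

end WitnessedEntanglement

end

/-! An LOCC protocol is a separable map, with product Kraus operators `a i ⊗ b i`. Its teleportation
quality on a resource `σ` is governed by the operator `M = fidelityOperator a b`: the entanglement
fidelity of the resulting channel is `F = Tr(M σ) / D²`. The proof bounds the distance below by `F`,
and bounds `F` above by a witness.

Distance to fidelity. For a pure state `φ` and an operator `Y` of unit trace, `‖φ - Y‖₁ ≥ 2 - 2 Tr(φ
Y)`, by testing against the reflection `2φ - 1`. Averaging over `φ` needs only the fourth moments of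
the uniform measure on the sphere (`sphereMoment_eq`). They give average fidelity `(D F + 1) / (D +
1)`, hence `d(Λ) ≥ 2D/(D+1) · (1 - F)` (`le_teleportationDistance`).

Fidelity to witness. Put `W = 1 - M / D`. Three inequalities, all consequences of Kraus completeness
and the product form, make `W` feasible (`mem_feasible_of_isComplete`): `M ≥ 0` gives `W ≤ 1`; `M ≤
D²` gives `W ≥ 1 - D ≥ -n`; and `M^{T_S} ≤ D` says that `W` is the partial transpose of a positive
operator, so it is a decomposable witness. The last one reflects that the partial transpose of `∑
|jj⟩⟨ll|` is the swap, whose eigenvalues are at most 1. Since `-Tr(W ρ) = D F - 1`, it follows that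
`F ≤ (1 + E) / D`.

Only the one transposition `T_S` is used, and it may be traded for the transposition of the
complementary group. This gives the single-party version when either group is a single party. -/

noncomputable section

namespace WitnessedEntanglement

/-! ### Trace norm: continuity and duality with unitaries -/

open Matrix in
/-- The trace of the functional calculus of a Hermitian matrix. -/
theorem trace_cfc {X : Type} [Fintype X] [DecidableEq X] {A : Matrix X X ℂ}
    (hA : A.IsHermitian) (f : ℝ → ℝ) :
    (cfc f A).trace = ∑ i, ((f (hA.eigenvalues i) : ℝ) : ℂ) := by
  rw [hA.cfc_eq, IsHermitian.cfc, Unitary.conjStarAlgAut_apply, trace_mul_comm, ← mul_assoc]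
  simp [trace_diagonal]

open scoped MatrixOrder Matrix.Norms.L2Operator in
theorem traceNorm_eq_trace_abs {X : Type} [Fintype X] [DecidableEq X] (A : Matrix X X ℂ) :
    traceNorm A = (CFC.abs A).trace.re := by
  have h : CFC.abs A = cfc Real.sqrt (Aᴴ * A) := by
    rw [CFC.abs, CFC.sqrt_eq_real_sqrt _ (star_mul_self_nonneg A), cfcₙ_eq_cfc]
    rfl
  rw [h, trace_cfc (Matrix.isHermitian_conjTranspose_mul_self A)]
  simp [traceNorm]

-- Continuity of the absolute value in the functional calculus does the work. It makes the integrand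
-- of the teleportation distance integrable, so that a pointwise lower bound passes to the integral.
open scoped MatrixOrder Matrix.Norms.L2Operator in
theorem continuous_traceNorm {X : Type} [Fintype X] [DecidableEq X] :
    Continuous (traceNorm : Matrix X X ℂ → ℝ) := by
  have h : (traceNorm : Matrix X X ℂ → ℝ) = fun A => (CFC.abs A).trace.re :=
    funext traceNorm_eq_trace_abs
  rw [h]
  have h2 : Continuous (CFC.abs : Matrix X X ℂ → Matrix X X ℂ) := CFC.continuous_abs
  exact Complex.continuous_re.comp h2.matrix_trace

open Matrix in
theorem trace_eq_sum_orthonormalBasis {X : Type} [Fintype X] [DecidableEq X]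
    (b : OrthonormalBasis X ℂ (EuclideanSpace ℂ X)) (M : Matrix X X ℂ) :
    M.trace = ∑ i, inner ℂ (b i) (toEuclideanLin M (b i)) := by
  rw [← LinearMap.trace_eq_sum_inner _ b]
  rw [Matrix.toEuclideanLin_eq_toLin_orthonormal, Matrix.trace_toLin_eq]

open Matrix in
/-- Duality between the trace norm and the operator norm, for unitary operators. -/
theorem re_trace_mul_le_traceNorm {X : Type} [Fintype X] [DecidableEq X] (A U : Matrix X X ℂ)
    (hU : Uᴴ * U = 1) : (U * A).trace.re ≤ traceNorm A := by
  have hA := Matrix.isHermitian_conjTranspose_mul_self A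
  have hsq : ∀ (M : Matrix X X ℂ) (v : EuclideanSpace ℂ X),
      ((‖toEuclideanLin M v‖ ^ 2 : ℝ) : ℂ) = inner ℂ v (toEuclideanLin (Mᴴ * M) v) := by
    intro M v
    rw [Complex.ofReal_pow]
    refine (inner_self_eq_norm_sq_to_K (𝕜 := ℂ) (toEuclideanLin M v)).symm.trans ?_
    simp only [EuclideanSpace.inner_eq_star_dotProduct, toLpLin_apply]
    rw [← mulVec_mulVec, dotProduct_comm, star_mulVec, ← dotProduct_mulVec, dotProduct_comm]
  have hnorm : ∀ v : EuclideanSpace ℂ X, ‖toEuclideanLin (U * A) v‖ = ‖toEuclideanLin A v‖ := by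
    intro v
    have h1 := hsq (U * A) v
    rw [conjTranspose_mul, Matrix.mul_assoc, ← Matrix.mul_assoc Uᴴ, hU, Matrix.one_mul,
      ← hsq A v] at h1
    have h2 := Complex.ofReal_injective h1
    exact (sq_eq_sq₀ (norm_nonneg _) (norm_nonneg _)).1 h2
  -- In an eigenbasis of `Aᴴ * A`, Cauchy–Schwarz bounds each diagonal entry of `U * A` by `‖A v‖`,
  -- which is the corresponding singular value.
  rw [trace_eq_sum_orthonormalBasis hA.eigenvectorBasis, Complex.re_sum, traceNorm]
  refine Finset.sum_le_sum fun i _ => ?_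
  have h3 : ‖toEuclideanLin A (hA.eigenvectorBasis i)‖ = Real.sqrt (hA.eigenvalues i) := by
    have h4 := congrArg Complex.re (hsq A (hA.eigenvectorBasis i))
    rw [Complex.ofReal_re] at h4
    rw [hA.eigenvalues_eq i, ← Real.sqrt_sq (norm_nonneg (toEuclideanLin A _)), h4]
    simp [EuclideanSpace.inner_eq_star_dotProduct, dotProduct_comm]
  refine (Complex.re_le_norm _).trans ((norm_inner_le_norm _ _).trans ?_)
  rw [hnorm, h3]
  simp

/-! ### Isometry invariance of the sphere measure -/

open MeasureTheory Metric

section Invariance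

variable {F : Type*} [NormedAddCommGroup F] [InnerProductSpace ℝ F] [MeasurableSpace F]
  [BorelSpace F] [FiniteDimensional ℝ F]

/-- The action of a linear isometry on the unit sphere. -/
def sphereMap (U : F ≃ₗᵢ[ℝ] F) (x : sphere (0 : F) 1) : sphere (0 : F) 1 :=
  ⟨U x, by simp⟩

omit [MeasurableSpace F] [BorelSpace F] [FiniteDimensional ℝ F] in
theorem continuous_sphereMap (U : F ≃ₗᵢ[ℝ] F) : Continuous (sphereMap U) :=
  (U.continuous.comp continuous_subtype_val).subtype_mk _

-- The surface measure of `s` is a constant times the volume of the cone `(0,1) • s`; isometries map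
-- cones to cones and preserve volume.
open Pointwise in
theorem measurePreserving_sphereMap (U : F ≃ₗᵢ[ℝ] F) :
    MeasurePreserving (sphereMap U) (volume : Measure F).toSphere (volume : Measure F).toSphere := by
  refine ⟨(continuous_sphereMap U).measurable, ?_⟩
  ext s hs
  rw [Measure.map_apply (continuous_sphereMap U).measurable hs,
    Measure.toSphere_apply' _ ((continuous_sphereMap U).measurable hs),
    Measure.toSphere_apply' _ hs]
  congr 1
  have h : (Set.Ioo (0 : ℝ) 1 • ((↑) '' (sphereMap U ⁻¹' s)) : Set F) =
      U ⁻¹' (Set.Ioo (0 : ℝ) 1 • ((↑) '' s)) := by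
    ext x
    simp only [Set.mem_smul, Set.mem_preimage, Set.mem_image]
    constructor
    · rintro ⟨r, hr, _, ⟨y, hy, rfl⟩, rfl⟩
      exact ⟨r, hr, _, ⟨_, hy, rfl⟩, by simp [sphereMap]⟩
    · rintro ⟨r, hr, _, ⟨y, hy, rfl⟩, h⟩
      refine ⟨r, hr, _, ⟨sphereMap U.symm y, ?_, rfl⟩, ?_⟩
      · simpa [sphereMap] using hy
      · apply U.injective
        simp [sphereMap, h]
  rw [h]
  exact U.measurePreserving.measure_preimage_emb U.toHomeomorph.measurableEmbedding _

theorem integral_toSphere_comp (U : F →ₗᵢ[ℝ] F) {f : F → ℂ} (hf : Continuous f) :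
    ∫ x : sphere (0 : F) 1, f (U x) ∂(volume : Measure F).toSphere =
      ∫ x : sphere (0 : F) 1, f x ∂(volume : Measure F).toSphere := by
  have h := measurePreserving_sphereMap (U.toLinearIsometryEquiv rfl)
  have h2 := integral_map (μ := (volume : Measure F).toSphere)
    (f := fun x : sphere (0 : F) 1 => f x) h.measurable.aemeasurable
    (hf.comp continuous_subtype_val).aestronglyMeasurable
  rw [h.map_eq] at h2
  exact h2.symm

end Invariance

/-! ### Fourth moments of the uniform measure on the sphere -/

variable {D : ℕ}

/-- The diagonal unitary that multiplies the coordinate `p` by the imaginary unit. -/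
def phaseIsometry (p : Fin D) : EuclideanSpace ℂ (Fin D) →ₗᵢ[ℝ] EuclideanSpace ℂ (Fin D) where
  toFun v := WithLp.toLp 2 fun q => (if q = p then Complex.I else 1) * v q
  map_add' v w := by ext q; simp [mul_add]
  map_smul' r v := by ext q; simp [mul_left_comm]
  norm_map' v := by
    simp only [EuclideanSpace.norm_eq]
    congr 1
    refine Finset.sum_congr rfl fun q _ => ?_
    simp only [LinearMap.coe_mk, AddHom.coe_mk]
    split_ifs <;> simp

/-- The Hadamard rotation in the plane of two coordinates. -/
def hadamardIsometry {p q : Fin D} (hpq : p ≠ q) :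
    EuclideanSpace ℂ (Fin D) →ₗᵢ[ℝ] EuclideanSpace ℂ (Fin D) where
  toFun v := WithLp.toLp 2 fun t =>
    if t = p then (√2 / 2 : ℝ) * (v p + v q) else if t = q then (√2 / 2 : ℝ) * (v p - v q) else v t
  map_add' v w := by
    ext t
    simp only [PiLp.add_apply]
    split_ifs <;> ring
  map_smul' r v := by
    ext t
    simp only [PiLp.smul_apply, RingHom.id_apply, Complex.real_smul]
    split_ifs <;> ring
  norm_map' v := by
    simp only [EuclideanSpace.norm_eq]
    congr 1
    rw [← sub_eq_zero, ← Finset.sum_sub_distrib,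
      Finset.sum_eq_add p q hpq (fun t _ ht => by simp [ht.1, ht.2]) (by simp) (by simp)]
    have h2 : (√2 / 2 : ℝ) ^ 2 = 1 / 2 := by
      rw [div_pow, Real.sq_sqrt (by norm_num)]; norm_num
    have h3 := parallelogram_law_with_norm ℂ (v p) (v q)
    simp only [LinearMap.coe_mk, AddHom.coe_mk, if_true, hpq.symm, if_false, norm_mul, mul_pow,
      Complex.norm_real, Real.norm_eq_abs, sq_abs, h2]
    linarith

/-- Fourth moments of the uniform measure on the unit sphere. -/
def sphereMoment (i j k l : Fin D) : ℂ :=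
  ∫ φ : sphere (0 : EuclideanSpace ℂ (Fin D)) 1,
    φ.1 i * star (φ.1 j) * φ.1 k * star (φ.1 l) ∂(volume : Measure _).toSphere

theorem integrable_toSphere {f : EuclideanSpace ℂ (Fin D) → ℂ} (hf : Continuous f) :
    Integrable (fun φ : sphere (0 : EuclideanSpace ℂ (Fin D)) 1 => f φ)
      (volume : Measure (EuclideanSpace ℂ (Fin D))).toSphere :=
  (hf.comp continuous_subtype_val).integrable_of_hasCompactSupport
    (HasCompactSupport.of_compactSpace _)

theorem continuous_quartic (i j k l : Fin D) : Continuous fun v : EuclideanSpace ℂ (Fin D) =>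
    v i * star (v j) * v k * star (v l) := by fun_prop

theorem sphereMoment_phase (p i j k l : Fin D) :
    (if i = p then Complex.I else 1) * star (if j = p then Complex.I else 1) *
      (if k = p then Complex.I else 1) * star (if l = p then Complex.I else 1) *
        sphereMoment i j k l = sphereMoment i j k l := by
  conv_rhs => rw [sphereMoment]
  rw [← integral_toSphere_comp (phaseIsometry p) (continuous_quartic i j k l), sphereMoment,
    ← integral_const_mul]
  congr 1
  ext φ
  simp only [phaseIsometry, LinearIsometry.coe_mk, LinearMap.coe_mk, AddHom.coe_mk, star_mul]
  ring

/-- If the unconjugated indices are not matched by the conjugated ones, some phase rotation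
multiplies the moment by a factor other than 1, yet invariance leaves it unchanged. -/
theorem sphereMoment_eq_zero {i j k l : Fin D} (h₁ : ¬(i = j ∧ k = l)) (h₂ : ¬(i = l ∧ k = j)) :
    sphereMoment i j k l = 0 := by
  have hI : Complex.I ≠ 1 := fun h => by simpa using congrArg Complex.re h
  have key : ∀ c : ℂ, c ≠ 1 → c * sphereMoment i j k l = sphereMoment i j k l →
      sphereMoment i j k l = 0 := by
    intro c hc h
    by_contra h0
    exact hc (mul_right_cancel₀ h0 (by rw [h, one_mul]))
  by_cases hij : i = j
  · subst hij
    have hkl : k ≠ l := fun h => h₁ ⟨rfl, h⟩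
    refine key Complex.I hI (Eq.trans ?_ (sphereMoment_phase k i i k l))
    rw [if_neg hkl.symm, if_pos rfl]
    split_ifs <;> simp only [Complex.star_def, Complex.conj_I, map_one]
    · linear_combination Complex.I * sphereMoment i i k l * Complex.I_mul_I
    · ring
  · by_cases hil : i = l
    · subst hil
      have hkj : k ≠ j := fun h => h₂ ⟨rfl, h⟩
      refine key Complex.I hI (Eq.trans ?_ (sphereMoment_phase k i j k i))
      rw [if_neg hkj.symm, if_pos rfl]
      split_ifs <;> simp only [Complex.star_def, Complex.conj_I, map_one]
      · linear_combination Complex.I * sphereMoment i j k i * Complex.I_mul_I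
      · ring
    · have h := sphereMoment_phase i i j k l
      rw [if_neg (Ne.symm hij), if_neg (Ne.symm hil), if_pos rfl] at h
      split_ifs at h
      -- Here `k = i`, so the phase enters twice and the factor is `I * I`.
      · refine key (-1) (by norm_num) ?_
        simpa using h
      · refine key Complex.I hI ?_
        simpa using h

theorem sphereMoment_swap (i j k l : Fin D) : sphereMoment i l k j = sphereMoment i j k l := by
  simp only [sphereMoment]
  congr 1
  ext φ
  ring

theorem sphereMoment_comm (i j k l : Fin D) : sphereMoment k j i l = sphereMoment i j k l := by
  simp only [sphereMoment]
  congr 1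
  ext φ
  ring

theorem integral_sum_quartic {ι : Type*} [Fintype ι] (x : ι → Fin D) (C : ι → ι → ι → ι → ℂ) :
    ∫ φ : sphere (0 : EuclideanSpace ℂ (Fin D)) 1,
      ∑ i, ∑ j, ∑ k, ∑ l,
        C i j k l * (φ.1 (x i) * star (φ.1 (x j)) * φ.1 (x k) * star (φ.1 (x l)))
        ∂(volume : Measure (EuclideanSpace ℂ (Fin D))).toSphere =
      ∑ i, ∑ j, ∑ k, ∑ l, C i j k l * sphereMoment (x i) (x j) (x k) (x l) := by
  have hI := fun i j k l => (integrable_toSphere (continuous_quartic (x i) (x j) (x k) (x l))).const_mul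
    (C i j k l)
  have hl := fun i j k => integrable_finsetSum Finset.univ fun l _ => hI i j k l
  have hk := fun i j => integrable_finsetSum Finset.univ fun k _ => hl i j k
  have hj := fun i => integrable_finsetSum Finset.univ fun j _ => hk i j
  rw [integral_finsetSum _ fun i _ => hj i]
  refine Finset.sum_congr rfl fun i _ => ?_
  rw [integral_finsetSum _ fun j _ => hk i j]
  refine Finset.sum_congr rfl fun j _ => ?_
  rw [integral_finsetSum _ fun k _ => hl i j k]
  refine Finset.sum_congr rfl fun k _ => ?_
  rw [integral_finsetSum _ fun l _ => hI i j k l]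
  exact Finset.sum_congr rfl fun l _ => integral_const_mul _ _

/-- Invariance under the Hadamard rotation equates the fourth moment of one coordinate with that of
`(v p ± v q) / √2`. Of the 16 terms in the expansion, six survive. Together the two identities give
`E|v p|⁴ = E|v q|⁴ = 2 E|v p|²|v q|²`. -/
theorem sphereMoment_hadamard {p q : Fin D} (hpq : p ≠ q) :
    4 * sphereMoment p p p p =
      sphereMoment p p p p + sphereMoment q q q q + 4 * sphereMoment p p q q ∧
    4 * sphereMoment q q q q =
      sphereMoment p p p p + sphereMoment q q q q + 4 * sphereMoment p p q q := by
  have h2 : ((√2 / 2 : ℝ) : ℂ) ^ 4 = 1 / 4 := by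
    rw [← Complex.ofReal_pow, div_pow, show (√2) ^ 4 = ((√2) ^ 2) ^ 2 by ring,
      Real.sq_sqrt (by norm_num)]
    norm_num
  -- Both signs at once: `ε = 1` for the rotated coordinate `p`, `ε = -1` for `q`.
  have gen : ∀ ε : ℂ, star ε = ε → ε ^ 2 = 1 →
      ∫ φ : sphere (0 : EuclideanSpace ℂ (Fin D)) 1,
        (φ.1 p + ε * φ.1 q) * star (φ.1 p + ε * φ.1 q) * (φ.1 p + ε * φ.1 q) *
          star (φ.1 p + ε * φ.1 q) ∂(volume : Measure _).toSphere =
      sphereMoment p p p p + sphereMoment q q q q + 4 * sphereMoment p p q q := by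
    intro ε hε hε2
    have h := integral_sum_quartic ![p, q]
      (fun a b c d => ![1, ε] a * ![1, ε] b * ![1, ε] c * ![1, ε] d)
    have e1 : sphereMoment q q p p = sphereMoment p p q q := by
      rw [← sphereMoment_comm, sphereMoment_swap]
    have e2 : sphereMoment q p p q = sphereMoment p p q q := by rw [sphereMoment_swap, e1]
    simp only [Fin.sum_univ_two, Matrix.cons_val_zero, Matrix.cons_val_one] at h
    rw [sphereMoment_eq_zero (i := p) (j := p) (k := p) (l := q) (by tauto) (by tauto),
      sphereMoment_eq_zero (i := p) (j := p) (k := q) (l := p) (by tauto) (by tauto),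
      sphereMoment_eq_zero (i := p) (j := q) (k := p) (l := p) (by tauto) (by tauto),
      sphereMoment_eq_zero (i := q) (j := p) (k := p) (l := p) (by tauto) (by tauto),
      sphereMoment_eq_zero (i := p) (j := q) (k := p) (l := q) (by tauto) (by tauto),
      sphereMoment_eq_zero (i := q) (j := p) (k := q) (l := p) (by tauto) (by tauto),
      sphereMoment_eq_zero (i := q) (j := q) (k := q) (l := p) (by tauto) (by tauto),
      sphereMoment_eq_zero (i := q) (j := q) (k := p) (l := q) (by tauto) (by tauto),
      sphereMoment_eq_zero (i := q) (j := p) (k := q) (l := q) (by tauto) (by tauto),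
      sphereMoment_eq_zero (i := p) (j := q) (k := q) (l := q) (by tauto) (by tauto),
      e1, e2, sphereMoment_swap p p q q] at h
    refine Eq.trans ?_ (h.trans ?_)
    · congr 1
      ext φ
      simp only [star_add, star_mul, hε]
      ring
    · linear_combination (4 * sphereMoment p p q q + (ε ^ 2 + 1) * sphereMoment q q q q) * hε2
  constructor
  · have h := integral_toSphere_comp (hadamardIsometry hpq) (continuous_quartic p p p p)
    rw [← gen 1 (by simp) (by simp), sphereMoment, ← h, ← integral_const_mul]
    congr 1
    ext φ
    simp only [hadamardIsometry, LinearIsometry.coe_mk, LinearMap.coe_mk, AddHom.coe_mk, star_mul,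
      if_true, Complex.star_def, Complex.conj_ofReal, one_mul]
    linear_combination (4 * (φ.1 p + φ.1 q) ^ 2 * (starRingEnd ℂ (φ.1 p + φ.1 q)) ^ 2) * h2
  · have h := integral_toSphere_comp (hadamardIsometry hpq) (continuous_quartic q q q q)
    rw [← gen (-1) (by simp) (by simp), sphereMoment, ← h, ← integral_const_mul]
    congr 1
    ext φ
    simp only [hadamardIsometry, LinearIsometry.coe_mk, LinearMap.coe_mk, AddHom.coe_mk, star_mul,
      if_true, hpq.symm, if_false, Complex.star_def, Complex.conj_ofReal, neg_one_mul,
      ← sub_eq_add_neg]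
    linear_combination (4 * (φ.1 p - φ.1 q) ^ 2 * (starRingEnd ℂ (φ.1 p - φ.1 q)) ^ 2) * h2

theorem sum_sphereMoment : ∑ i, ∑ k, sphereMoment (D := D) i i k k =
    (((volume : Measure (EuclideanSpace ℂ (Fin D))).toSphere.real Set.univ : ℝ) : ℂ) := by
  simp only [sphereMoment]
  have hI := fun i j k l : Fin D => integrable_toSphere (continuous_quartic i j k l)
  simp_rw [← integral_finsetSum _ fun k _ => hI _ _ k k]
  rw [← integral_finsetSum _ fun i _ => integrable_finsetSum _ fun k _ => hI i i k k]
  have h : ∀ φ : sphere (0 : EuclideanSpace ℂ (Fin D)) 1,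
      ∑ i, ∑ k, φ.1 i * star (φ.1 i) * φ.1 k * star (φ.1 k) = 1 := by
    intro φ
    have h1 : ∑ i, φ.1 i * star (φ.1 i) = 1 := by
      have h2 : ‖φ.1‖ = 1 := by simp
      have h3 := EuclideanSpace.norm_sq_eq φ.1
      rw [h2, one_pow] at h3
      simp only [Complex.star_def, Complex.mul_conj, Complex.normSq_eq_norm_sq]
      exact_mod_cast h3.symm
    simp_rw [mul_assoc _ (φ.1 _) (star _), ← Finset.mul_sum, h1, mul_one, h1]
  simp only [h, integral_const, Complex.real_smul, mul_one]

/-- Up to the common value `a` of the diagonal moments, phase and Hadamard invariance determine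
everything. Summing over `i = j`, `k = l`, where the integrand is `‖φ‖⁴ = 1`, fixes `a / 2 * (D² +
D)` as the total mass. -/
theorem sphereMoment_eq (i j k l : Fin D) :
    sphereMoment i j k l =
      (((volume : Measure (EuclideanSpace ℂ (Fin D))).toSphere.real Set.univ : ℝ) : ℂ) /
        (D * (D + 1)) * ((if i = j ∧ k = l then 1 else 0) + (if i = l ∧ k = j then 1 else 0)) := by
  have hD : (D : ℂ) ≠ 0 := by
    have := i.pos
    exact_mod_cast this.ne'
  have hD1 : (D : ℂ) + 1 ≠ 0 := by exact_mod_cast D.succ_ne_zero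
  obtain ⟨a, ha⟩ : ∃ a, a = sphereMoment i i i i := ⟨_, rfl⟩
  have hdiag : ∀ p : Fin D, sphereMoment p p p p = a := by
    intro p
    rw [ha]
    by_cases hp : p = i
    · rw [hp]
    · have h := sphereMoment_hadamard hp
      linear_combination (h.1 - h.2) / 4
  have hoff : ∀ p q : Fin D, sphereMoment p p q q =
      a / 2 * (1 + if p = q then 1 else 0) := by
    intro p q
    split_ifs with hpq
    · rw [hpq, hdiag]; ring
    · have h := (sphereMoment_hadamard hpq).1
      rw [hdiag, hdiag q] at h
      linear_combination (-1 / 4) * h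
  have hsum := sum_sphereMoment (D := D)
  simp_rw [hoff, ← Finset.mul_sum, Finset.sum_add_distrib] at hsum
  simp only [Finset.sum_const, Finset.card_univ, Fintype.card_fin, nsmul_eq_mul, mul_one,
    Finset.sum_ite_eq, Finset.mem_univ, if_true] at hsum
  have hV : (((volume : Measure (EuclideanSpace ℂ (Fin D))).toSphere.real Set.univ : ℝ) : ℂ) /
      (D * (D + 1)) = a / 2 := by
    rw [← hsum]
    field_simp
  rw [hV]
  by_cases h₁ : i = j ∧ k = l
  · obtain ⟨rfl, rfl⟩ := h₁
    rw [hoff]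
    rcases eq_or_ne i k with rfl | h
    · simp
    · simp [h]
  · by_cases h₂ : i = l ∧ k = j
    · obtain ⟨rfl, rfl⟩ := h₂
      rw [sphereMoment_swap, hoff]
      rcases eq_or_ne i k with rfl | h
      · simp
      · simp [h]
    · rw [sphereMoment_eq_zero h₁ h₂, if_neg h₁, if_neg h₂]
      ring

/-- Averages of quartic forms over the uniformly distributed pure states. -/
theorem average_quartic [NeZero D] (C : Fin D → Fin D → Fin D → Fin D → ℂ) :
    ⨍ φ : sphere (0 : EuclideanSpace ℂ (Fin D)) 1,
      ∑ i, ∑ j, ∑ k, ∑ l, C i j k l * (φ.1 i * star (φ.1 j) * φ.1 k * star (φ.1 l))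
        ∂(volume : Measure (EuclideanSpace ℂ (Fin D))).toSphere =
      (∑ i, ∑ k, C i i k k + ∑ i, ∑ k, C i k k i) / (D * (D + 1)) := by
  rw [average_eq, integral_sum_quartic (fun i => i)]
  have hV : (((volume : Measure (EuclideanSpace ℂ (Fin D))).toSphere.real Set.univ : ℝ) : ℂ) ≠ 0 := by
    rw [Complex.ofReal_ne_zero, measureReal_ne_zero_iff]
    exact (Measure.measure_univ_ne_zero.2 (Measure.toSphere_ne_zero _))
  set V := (volume : Measure (EuclideanSpace ℂ (Fin D))).toSphere.real Set.univ
  have e₁ : ∑ i, ∑ j, ∑ k, ∑ l, C i j k l * (if i = j ∧ k = l then 1 else 0) =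
      ∑ i, ∑ k, C i i k k := by
    refine Finset.sum_congr rfl fun i _ => ?_
    rw [Finset.sum_eq_single i (fun j _ hj => by simp [hj.symm]) (by simp)]
    simp
  have e₂ : ∑ i, ∑ j, ∑ k, ∑ l, C i j k l * (if i = l ∧ k = j then 1 else 0) =
      ∑ i, ∑ k, C i k k i := by
    refine Finset.sum_congr rfl fun i _ => Finset.sum_congr rfl fun j _ => ?_
    rw [Finset.sum_eq_single j (fun k _ hk => by simp [hk]) (by simp)]
    simp
  have e₃ : ∑ i, ∑ j, ∑ k, ∑ l, C i j k l * sphereMoment i j k l =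
      V / (D * (D + 1)) * (∑ i, ∑ k, C i i k k + ∑ i, ∑ k, C i k k i) := by
    rw [← e₁, ← e₂]
    simp only [mul_add, Finset.mul_sum, ← Finset.sum_add_distrib]
    refine Finset.sum_congr rfl fun i _ => Finset.sum_congr rfl fun j _ =>
      Finset.sum_congr rfl fun k _ => Finset.sum_congr rfl fun l _ => ?_
    rw [sphereMoment_eq]
    ring
  rw [e₃, Complex.real_smul, Complex.ofReal_inv]
  field_simp

/-! ### LOCC protocols as separable maps -/

/-- Every LOCC map is a separable map: it has a Kraus decomposition with product operators. -/
theorem IsLOCC.exists_kraus {γ δ : Type} [Fintype γ] [DecidableEq γ] [Fintype δ] [DecidableEq δ]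
    {α β : Type} [Fintype α] [DecidableEq α] [Fintype β] [DecidableEq β]
    {Φ : Matrix (α × β) (α × β) ℂ → Matrix (γ × δ) (γ × δ) ℂ} (h : IsLOCC α β Φ) :
    ∃ (I : Type) (_ : Fintype I) (a : I → Matrix γ α ℂ) (b : I → Matrix δ β ℂ),
      (∀ X, Φ X = ∑ i, (a i ⊗ₖ b i) * X * (a i ⊗ₖ b i)ᴴ) ∧
        ∑ i, (a i ⊗ₖ b i)ᴴ * (a i ⊗ₖ b i) = 1 := by
  induction h with
  | done => exact ⟨Unit, inferInstance, fun _ => 1, fun _ => 1, by simp, by simp⟩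
  | alice α β ι α' K hK Φ hΦ ih =>
    choose I hI a b h₁ h₂ using ih
    refine ⟨Σ i, I i, inferInstance, fun s => a s.1 s.2 * K s.1, fun s => b s.1 s.2, ?_, ?_⟩
    · intro X
      rw [Fintype.sum_sigma]
      refine Finset.sum_congr rfl fun i _ => ?_
      rw [h₁]
      refine Finset.sum_congr rfl fun s _ => ?_
      have : (a i s * K i) ⊗ₖ b i s = (a i s ⊗ₖ b i s) * (K i ⊗ₖ (1 : Matrix β β ℂ)) := by
        rw [← Matrix.mul_kronecker_mul, Matrix.mul_one]
      rw [this, Matrix.conjTranspose_mul]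
      simp only [Matrix.mul_assoc]
    · rw [Fintype.sum_sigma, ← Matrix.one_kronecker_one, ← hK]
      have hs : ∀ i, ∑ s, ((a i s * K i) ⊗ₖ b i s)ᴴ * ((a i s * K i) ⊗ₖ b i s) =
          ((K i)ᴴ * K i) ⊗ₖ (1 : Matrix β β ℂ) := by
        intro i
        have : ∀ s, (a i s * K i) ⊗ₖ b i s = (a i s ⊗ₖ b i s) * (K i ⊗ₖ (1 : Matrix β β ℂ)) := by
          intro s
          rw [← Matrix.mul_kronecker_mul, Matrix.mul_one]
        simp_rw [this, Matrix.conjTranspose_mul, Matrix.mul_assoc]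
        rw [← Matrix.mul_sum]
        simp_rw [← Matrix.mul_assoc (a i _ ⊗ₖ b i _)ᴴ]
        rw [← Matrix.sum_mul, h₂ i, Matrix.one_mul, Matrix.conjTranspose_kronecker,
          ← Matrix.mul_kronecker_mul]
        simp
      simp only [hs]
      ext x y
      simp [Matrix.sum_apply, Matrix.kroneckerMap_apply, Finset.sum_mul]
  | bob α β ι β' K hK Φ hΦ ih =>
    choose I hI a b h₁ h₂ using ih
    refine ⟨Σ i, I i, inferInstance, fun s => a s.1 s.2, fun s => b s.1 s.2 * K s.1, ?_, ?_⟩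
    · intro X
      rw [Fintype.sum_sigma]
      refine Finset.sum_congr rfl fun i _ => ?_
      rw [h₁]
      refine Finset.sum_congr rfl fun s _ => ?_
      have : a i s ⊗ₖ (b i s * K i) = (a i s ⊗ₖ b i s) * ((1 : Matrix α α ℂ) ⊗ₖ K i) := by
        rw [← Matrix.mul_kronecker_mul, Matrix.mul_one]
      rw [this, Matrix.conjTranspose_mul]
      simp only [Matrix.mul_assoc]
    · rw [Fintype.sum_sigma, ← Matrix.one_kronecker_one, ← hK]
      have hs : ∀ i, ∑ s, (a i s ⊗ₖ (b i s * K i))ᴴ * (a i s ⊗ₖ (b i s * K i)) =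
          (1 : Matrix α α ℂ) ⊗ₖ ((K i)ᴴ * K i) := by
        intro i
        have : ∀ s, a i s ⊗ₖ (b i s * K i) = (a i s ⊗ₖ b i s) * ((1 : Matrix α α ℂ) ⊗ₖ K i) := by
          intro s
          rw [← Matrix.mul_kronecker_mul, Matrix.mul_one]
        simp_rw [this, Matrix.conjTranspose_mul, Matrix.mul_assoc]
        rw [← Matrix.mul_sum]
        simp_rw [← Matrix.mul_assoc (a i _ ⊗ₖ b i _)ᴴ]
        rw [← Matrix.sum_mul, h₂ i, Matrix.one_mul, Matrix.conjTranspose_kronecker,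
          ← Matrix.mul_kronecker_mul]
        simp
      simp only [hs]
      ext x y
      simp [Matrix.sum_apply, Matrix.kroneckerMap_apply, Finset.mul_sum]

/-- A product Kraus family that implements a teleportation protocol: the amplitude `u i j l x` of
the operator with outcome `i` maps the input `j` and the resource `x` to the output `l`. -/
theorem IsLOCC.exists_amplitudes {D : ℕ} {A B : Type} [Fintype A] [DecidableEq A] [Fintype B]
    [DecidableEq B] {Φ : Matrix ((Fin D × A) × B) ((Fin D × A) × B) ℂ →
      Matrix (Unit × Fin D) (Unit × Fin D) ℂ} (h : IsLOCC (Fin D × A) B Φ) :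
    ∃ (I : Type) (_ : Fintype I) (a : I → Fin D → A → ℂ) (b : I → Fin D → B → ℂ),
      (∀ (σ : Matrix (A × B) (A × B) ℂ) (X : Matrix (Fin D) (Fin D) ℂ) (l l' : Fin D),
        teleportChannel σ Φ X l l' = ∑ j, ∑ j', X j j' * ∑ i, ∑ x, ∑ y,
          a i j x.1 * b i l x.2 * σ x y * star (a i j' y.1 * b i l' y.2)) ∧
      ∀ (j j' : Fin D) (x y : A × B),
        ∑ i, ∑ l, star (a i j x.1 * b i l x.2) * (a i j' y.1 * b i l y.2) =
          if j = j' ∧ x = y then 1 else 0 := by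
  obtain ⟨I, hI, a, b, h₁, h₂⟩ := h.exists_kraus
  refine ⟨I, hI, fun i j p => a i () (j, p), fun i l q => b i l q, ?_, ?_⟩
  · intro σ X l l'
    have e : teleportChannel σ Φ X l l' = ∑ i, ∑ j', ∑ y : A × B, (∑ j, ∑ x : A × B,
        a i () (j, x.1) * b i l x.2 * (X j j' * σ x y)) *
          star (a i () (j', y.1) * b i l' y.2) := by
      simp only [teleportChannel, Matrix.of_apply, h₁, Matrix.sum_apply, Matrix.mul_apply,
        Matrix.kroneckerMap_apply, Matrix.conjTranspose_apply, Fintype.sum_prod_type]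
    rw [e]
    simp only [Finset.mul_sum, Finset.sum_mul]
    calc _ = ∑ i, ∑ j, ∑ j', ∑ x : A × B, ∑ y : A × B, a i () (j, x.1) * b i l x.2 *
              (X j j' * σ x y) * star (a i () (j', y.1) * b i l' y.2) := by
            refine Finset.sum_congr rfl fun i _ => ?_
            refine Eq.trans ?_ Finset.sum_comm
            refine Finset.sum_congr rfl fun j' _ => ?_
            rw [Finset.sum_comm]
            exact Finset.sum_congr rfl fun j _ => Finset.sum_comm
      _ = _ := by
            rw [Finset.sum_comm]
            refine Finset.sum_congr rfl fun j _ => ?_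
            rw [Finset.sum_comm]
            refine Finset.sum_congr rfl fun j' _ => Finset.sum_congr rfl fun i _ =>
              Finset.sum_congr rfl fun x _ => Finset.sum_congr rfl fun y _ => ?_
            ring
  · intro j j' x y
    have e := congrFun (congrFun h₂ ((j, x.1), x.2)) ((j', y.1), y.2)
    simp only [Matrix.sum_apply, Matrix.mul_apply, Matrix.conjTranspose_apply,
      Matrix.kroneckerMap_apply, Fintype.sum_prod_type, Matrix.one_apply, Prod.mk.injEq,
      Finset.univ_unique, Finset.sum_singleton] at e
    refine e.trans (if_congr ?_ rfl rfl)
    rw [Prod.ext_iff, and_assoc]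

/-! ### From teleportation distance to entanglement fidelity -/

theorem isHermitian_pureState (φ : sphere (0 : EuclideanSpace ℂ (Fin D)) 1) :
    (pureState φ)ᴴ = pureState φ := by
  ext i j
  simp [pureState, mul_comm]

theorem trace_pureState (φ : sphere (0 : EuclideanSpace ℂ (Fin D)) 1) :
    (pureState φ).trace = 1 := by
  have h := EuclideanSpace.norm_sq_eq φ.1
  rw [show ‖φ.1‖ = 1 by simp, one_pow] at h
  simp only [Matrix.trace, Matrix.diag, pureState, Matrix.of_apply, Complex.star_def,
    Complex.mul_conj, Complex.normSq_eq_norm_sq]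
  exact_mod_cast h.symm

theorem pureState_mul_self (φ : sphere (0 : EuclideanSpace ℂ (Fin D)) 1) :
    pureState φ * pureState φ = pureState φ := by
  have h := trace_pureState φ
  ext i j
  simp only [Matrix.trace, Matrix.diag, pureState, Matrix.of_apply] at h
  simp only [Matrix.mul_apply, pureState, Matrix.of_apply]
  calc _ = ∑ k, φ.1 i * star (φ.1 j) * (φ.1 k * star (φ.1 k)) :=
        Finset.sum_congr rfl fun k _ => by ring
    _ = _ := by rw [← Finset.mul_sum, h, mul_one]

/-- The trace distance between a pure state and an operator of unit trace is at least twice the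
infidelity. -/
theorem two_sub_fidelity_le_traceNorm (φ : sphere (0 : EuclideanSpace ℂ (Fin D)) 1)
    {Y : Matrix (Fin D) (Fin D) ℂ} (hY : Y.trace = 1) :
    2 - 2 * (pureState φ * Y).trace.re ≤ traceNorm (pureState φ - Y) := by
  -- The reflection `2φ - 1` is the test unitary: `Tr((2φ - 1)(φ - Y)) = 2 - 2 Tr(φ Y)` when `Tr Y =
  -- 1`.
  have hU : ((2 : ℂ) • pureState φ - 1)ᴴ * ((2 : ℂ) • pureState φ - 1) = 1 := by
    rw [Matrix.conjTranspose_sub, Matrix.conjTranspose_smul, isHermitian_pureState]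
    simp only [sub_mul, mul_sub, smul_mul_assoc, mul_smul_comm, pureState_mul_self]
    simp only [star_ofNat, Matrix.conjTranspose_one, Matrix.mul_one, Matrix.one_mul]
    module
  refine le_trans (le_of_eq ?_) (re_trace_mul_le_traceNorm _ _ hU)
  simp only [sub_mul, mul_sub, smul_mul_assoc, pureState_mul_self, Matrix.one_mul,
    Matrix.trace_sub, Matrix.trace_smul, trace_pureState, hY]
  simp [Complex.mul_re]

theorem continuous_pureState : Continuous (pureState (D := D)) := by
  refine continuous_matrix fun i j => ?_
  simp only [pureState, Matrix.of_apply]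
  fun_prop

/-- The teleportation distance of a trace-preserving linear map is bounded below in terms of its
entanglement fidelity. -/
theorem le_teleportationDistance [NeZero D] {Λ : Matrix (Fin D) (Fin D) ℂ → Matrix (Fin D) (Fin D) ℂ}
    (C : Fin D → Fin D → Fin D → Fin D → ℂ)
    (hΛ : ∀ X l l', Λ X l l' = ∑ j, ∑ j', X j j' * C l l' j j')
    (htr : ∀ j j', ∑ l, C l l j j' = if j = j' then 1 else 0) :
    2 * (D : ℝ) / (D + 1) * (1 - (∑ i, ∑ k, C i k i k).re / (D : ℝ) ^ 2) ≤
      teleportationDistance Λ := by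
  have hD : (D : ℝ) ≠ 0 := Nat.cast_ne_zero.2 (NeZero.ne D)
  have hD1 : (D : ℝ) + 1 ≠ 0 := by positivity
  set f : sphere (0 : EuclideanSpace ℂ (Fin D)) 1 → ℂ := fun φ =>
    ∑ i, ∑ j, ∑ k, ∑ l, C l k i j * (φ.1 i * star (φ.1 j) * φ.1 k * star (φ.1 l)) with hf
  set μ := (volume : Measure (EuclideanSpace ℂ (Fin D))).toSphere
  have hpt : ∀ φ, 2 - 2 * (f φ).re ≤ traceNorm (pureState φ - Λ (pureState φ)) := by
    intro φ
    have h1 : (Λ (pureState φ)).trace = 1 := by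
      rw [← trace_pureState φ]
      simp only [Matrix.trace, Matrix.diag, hΛ]
      rw [Finset.sum_comm]
      refine Finset.sum_congr rfl fun j _ => ?_
      rw [Finset.sum_comm]
      simp_rw [← Finset.mul_sum, htr]
      simp
    refine le_trans (le_of_eq ?_) (two_sub_fidelity_le_traceNorm φ h1)
    congr 3
    simp only [hf, Matrix.trace, Matrix.diag, Matrix.mul_apply, hΛ, Finset.mul_sum]
    refine ((Finset.sum_congr rfl fun i _ => Finset.sum_comm).trans Finset.sum_comm).trans
      (Finset.sum_congr rfl fun k _ =>
        ((Finset.sum_congr rfl fun i _ => Finset.sum_comm).trans Finset.sum_comm).trans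
          (Finset.sum_congr rfl fun l _ => Finset.sum_congr rfl fun i _ =>
            Finset.sum_congr rfl fun j _ => ?_))
    simp only [pureState, Matrix.of_apply]
    ring
  have hcf : Continuous f := by
    rw [hf]
    fun_prop
  have hΛc : Continuous Λ := by
    refine continuous_matrix fun l l' => ?_
    simp only [hΛ]
    fun_prop
  have hfi : Integrable f μ := hcf.integrable_of_hasCompactSupport (.of_compactSpace _)
  have hfre : Integrable (fun φ => (f φ).re) μ := hfi.re
  have hti : Integrable (fun φ => traceNorm (pureState φ - Λ (pureState φ))) μ :=
    (continuous_traceNorm.comp (continuous_pureState.sub (hΛc.comp continuous_pureState)))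
      |>.integrable_of_hasCompactSupport (.of_compactSpace _)
  have hV : μ.real Set.univ ≠ 0 := by
    rw [measureReal_ne_zero_iff]
    exact Measure.measure_univ_ne_zero.2 (Measure.toSphere_ne_zero _)
  have hVpos : 0 < μ.real Set.univ := lt_of_le_of_ne measureReal_nonneg hV.symm
  -- The first pairing of indices is the trace of `Λ(1)`, equal to `D`; the second is `D²` times the
  -- entanglement fidelity.
  have havg : ⨍ φ, f φ ∂μ = (∑ i, ∑ k, C k k i i + ∑ i, ∑ k, C i k i k) / (D * (D + 1)) :=
    average_quartic fun i j k l => C l k i j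
  have htrsum : ∑ i, ∑ k, C k k i i = (D : ℂ) := by simp [htr]
  rw [htrsum, average_eq] at havg
  have hre : ∫ φ, (f φ).re ∂μ = μ.real Set.univ *
      ((D + (∑ i, ∑ k, C i k i k).re) / (D * (D + 1))) := by
    have h := congrArg Complex.re havg
    rw [Complex.smul_re, ← show ∫ φ, (f φ).re ∂μ = (∫ φ, f φ ∂μ).re from integral_re hfi] at h
    have h2 : ((D + ∑ i, ∑ k, C i k i k) / ((D : ℂ) * (D + 1))).re =
        (D + (∑ i, ∑ k, C i k i k).re) / (D * (D + 1)) := by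
      have : (D : ℂ) * (D + 1) = ((D * (D + 1) : ℝ) : ℂ) := by push_cast; ring
      rw [this, Complex.div_ofReal_re, Complex.add_re, Complex.natCast_re]
    rw [← h2, ← h, smul_eq_mul, mul_inv_cancel_left₀ hV]
  rw [teleportationDistance, average_eq, smul_eq_mul]
  have hmono : ∫ φ, (2 - 2 * (f φ).re) ∂μ ≤
      ∫ φ, traceNorm (pureState φ - Λ (pureState φ)) ∂μ :=
    integral_mono ((integrable_const _).sub (hfre.const_mul 2)) hti hpt
  have hint : ∫ φ, (2 - 2 * (f φ).re) ∂μ = μ.real Set.univ * (2 * (D : ℝ) / (D + 1) *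
      (1 - (∑ i, ∑ k, C i k i k).re / (D : ℝ) ^ 2)) := by
    rw [integral_sub (integrable_const _) (hfre.const_mul 2), integral_const,
      integral_const_mul, hre, smul_eq_mul]
    field_simp
    ring
  rw [hint] at hmono
  rwa [← div_eq_inv_mul, le_div_iff₀' hVpos]

/-! ### Operator inequalities for the fidelity operator -/

section Bipartite

variable {I A B : Type} [Fintype I] {D : ℕ}

theorem posSemidef_sum_star_mul {X s : Type} [Fintype X] [Fintype s] (w : s → X → ℂ) :
    (Matrix.of fun x y => ∑ i, star (w i x) * w i y).PosSemidef := by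
  have h : (Matrix.of fun x y => ∑ i, star (w i x) * w i y) =
      ∑ i, Matrix.vecMulVec (star (w i)) (w i) := by
    ext x y
    simp [Matrix.sum_apply, Matrix.vecMulVec_apply]
  rw [h]
  exact Matrix.posSemidef_sum _ fun i _ => Matrix.posSemidef_vecMulVec_star_self _

/-- The operator whose expectation value in the resource state is, up to normalization, the
entanglement fidelity of the protocol with product Kraus operators `a i ⊗ b i`. -/
def fidelityOperator (a : I → Fin D → A → ℂ) (b : I → Fin D → B → ℂ) :
    Matrix (A × B) (A × B) ℂ :=
  Matrix.of fun x y => ∑ i, star (∑ j, a i j x.1 * b i j x.2) * ∑ j, a i j y.1 * b i j y.2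

/-- Partial transposition with respect to the first factor. -/
def transposeFst (M : Matrix (A × B) (A × B) ℂ) : Matrix (A × B) (A × B) ℂ :=
  Matrix.of fun x y => M (y.1, x.2) (x.1, y.2)

theorem transposeFst_one_sub_smul [DecidableEq A] [DecidableEq B] (c : ℂ)
    (M : Matrix (A × B) (A × B) ℂ) : transposeFst (1 - c • transposeFst M) = 1 - c • M := by
  ext x y
  simp only [transposeFst, Matrix.of_apply, Matrix.sub_apply, Matrix.smul_apply, Matrix.one_apply]
  refine congrArg₂ _ (if_congr ?_ rfl rfl) rfl
  simp only [Prod.ext_iff, eq_comm]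

/-- The Kraus operators `a i ⊗ b i` form a complete measurement. -/
def IsComplete [DecidableEq A] [DecidableEq B] (a : I → Fin D → A → ℂ) (b : I → Fin D → B → ℂ) :
    Prop :=
  ∀ (j j' : Fin D) (x y : A × B),
    ∑ i, ∑ l, star (a i j x.1 * b i l x.2) * (a i j' y.1 * b i l y.2) =
      if j = j' ∧ x = y then 1 else 0

theorem sum_sub_mul_sub (p q : Fin D → ℂ) :
    ∑ j, ∑ l, (p j - p l) * (q j - q l) = 2 * (D * ∑ j, p j * q j - (∑ j, p j) * ∑ j, q j) := by
  simp only [sub_mul, mul_sub, Finset.sum_sub_distrib, Finset.sum_const, Finset.card_univ,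
    Fintype.card_fin, nsmul_eq_mul, ← Finset.mul_sum, ← Finset.sum_mul]
  ring

variable [Fintype A] [Fintype B] (a : I → Fin D → A → ℂ) (b : I → Fin D → B → ℂ)

theorem posSemidef_fidelityOperator : (fidelityOperator a b).PosSemidef :=
  posSemidef_sum_star_mul fun i (x : A × B) => ∑ j, a i j x.1 * b i j x.2

variable [DecidableEq A] [DecidableEq B] {a b}

/-- With `u j l = a j * b l`, completeness gives `∑ |u j l|² = D`. Discarding `j ≠ l` and applying
Cauchy–Schwarz to `∑ u j j` costs a further factor `D`. The two losses are displayed as explicit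
sums of rank-one positive operators. -/
theorem IsComplete.posSemidef_sub_fidelityOperator (h : IsComplete a b) :
    (((D : ℂ) ^ 2) • (1 : Matrix (A × B) (A × B) ℂ) - fidelityOperator a b).PosSemidef := by
  set u : I → Fin D → Fin D → A × B → ℂ := fun i j l x => a i j x.1 * b i l x.2 with hu
  have h₁ := posSemidef_sum_star_mul fun (s : I × Fin D × Fin D) (x : A × B) =>
    if s.2.1 = s.2.2 then 0 else u s.1 s.2.1 s.2.2 x
  have h₂ := posSemidef_sum_star_mul fun (s : I × Fin D × Fin D) (x : A × B) =>
    u s.1 s.2.1 s.2.1 x - u s.1 s.2.2 s.2.2 x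
  have e : ((D : ℂ) ^ 2) • (1 : Matrix (A × B) (A × B) ℂ) - fidelityOperator a b =
      (D : ℂ) • (Matrix.of fun x y => ∑ s : I × Fin D × Fin D,
        star (if s.2.1 = s.2.2 then 0 else u s.1 s.2.1 s.2.2 x) *
          (if s.2.1 = s.2.2 then 0 else u s.1 s.2.1 s.2.2 y)) +
      (1 / 2 : ℂ) • Matrix.of fun x y => ∑ s : I × Fin D × Fin D,
        star (u s.1 s.2.1 s.2.1 x - u s.1 s.2.2 s.2.2 x) *
          (u s.1 s.2.1 s.2.1 y - u s.1 s.2.2 s.2.2 y) := by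
    ext x y
    have hc : ∑ i, ∑ j, ∑ l, star (u i j l x) * u i j l y = D * if x = y then 1 else 0 := by
      rw [Finset.sum_comm]
      simp only [hu, h _ _ x y, true_and, Finset.sum_const, Finset.card_univ, Fintype.card_fin,
        nsmul_eq_mul]
    have hoff : ∀ i, ∑ j, ∑ l, star (if j = l then 0 else u i j l x) *
        (if j = l then 0 else u i j l y) = ∑ j, ∑ l, star (u i j l x) * u i j l y -
          ∑ j, star (u i j j x) * u i j j y := by
      intro i
      rw [← Finset.sum_sub_distrib]
      refine Finset.sum_congr rfl fun j _ => ?_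
      have : ∀ l, star (if j = l then 0 else u i j l x) * (if j = l then 0 else u i j l y) =
          star (u i j l x) * u i j l y - if j = l then star (u i j l x) * u i j l y else 0 := by
        intro l
        split_ifs <;> simp
      simp only [this, Finset.sum_sub_distrib, Finset.sum_ite_eq, Finset.mem_univ, if_true]
    simp only [Matrix.sub_apply, Matrix.add_apply, Matrix.smul_apply, Matrix.of_apply,
      Fintype.sum_prod_type, hoff, star_sub, sum_sub_mul_sub, Finset.sum_sub_distrib, hc,
      ← Finset.mul_sum, fidelityOperator, star_sum, Matrix.one_apply, smul_eq_mul]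
    ring
  rw [e]
  exact (h₁.smul (by positivity)).add (h₂.smul (by norm_num [Complex.le_def]))

/-- Conjugating Alice's amplitudes turns the partial transpose into `∑ star (w l j) * w j l`, a swap
form, and `D` minus it is half the sum of squares of the antisymmetric parts `w j l - w l j`. The
product structure of the Kraus operators is essential here. -/
theorem IsComplete.posSemidef_sub_transposeFst (h : IsComplete a b) :
    ((D : ℂ) • (1 : Matrix (A × B) (A × B) ℂ) -
      transposeFst (fidelityOperator a b)).PosSemidef := by
  set w : I → Fin D → Fin D → A × B → ℂ := fun i j l x => star (a i j x.1) * b i l x.2 with hw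
  have h₁ := posSemidef_sum_star_mul fun (s : I × Fin D × Fin D) (x : A × B) =>
    w s.1 s.2.1 s.2.2 x - w s.1 s.2.2 s.2.1 x
  have e : (D : ℂ) • (1 : Matrix (A × B) (A × B) ℂ) - transposeFst (fidelityOperator a b) =
      (1 / 2 : ℂ) • Matrix.of fun x y => ∑ s : I × Fin D × Fin D,
        star (w s.1 s.2.1 s.2.2 x - w s.1 s.2.2 s.2.1 x) *
          (w s.1 s.2.1 s.2.2 y - w s.1 s.2.2 s.2.1 y) := by
    ext x y
    have hc : ∑ i, ∑ j, ∑ l, star (w i j l x) * w i j l y = D * if x = y then 1 else 0 := by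
      rw [Finset.sum_comm]
      have h3 : ∀ j, ∑ i, ∑ l, star (w i j l x) * w i j l y = if x = y then 1 else 0 := by
        intro j
        -- Completeness is read with Alice's indices exchanged, which is harmless because the
        -- identity is its own partial transpose.
        have h4 := h j j (y.1, x.2) (x.1, y.2)
        refine Eq.trans ?_ (h4.trans (if_congr ?_ rfl rfl))
        · refine Finset.sum_congr rfl fun i _ => Finset.sum_congr rfl fun l _ => ?_
          simp only [hw, star_mul, star_star]
          ring
        · simp [Prod.ext_iff, eq_comm]
      simp only [h3, Finset.sum_const, Finset.card_univ, Fintype.card_fin, nsmul_eq_mul]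
    have hc' : ∑ i, ∑ j, ∑ l, star (w i l j x) * w i l j y = D * if x = y then 1 else 0 := by
      rw [← hc]
      exact Finset.sum_congr rfl fun i _ => Finset.sum_comm
    have hx : ∑ i, ∑ j, ∑ l, star (w i j l x) * w i l j y =
        transposeFst (fidelityOperator a b) x y := by
      simp only [transposeFst, fidelityOperator, Matrix.of_apply, star_sum, Finset.sum_mul_sum]
      refine Finset.sum_congr rfl fun i _ => ?_
      rw [Finset.sum_comm]
      refine Finset.sum_congr rfl fun j _ => Finset.sum_congr rfl fun l _ => ?_
      simp only [hw, star_mul, star_star]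
      ring
    have hx' : ∑ i, ∑ j, ∑ l, star (w i l j x) * w i j l y =
        transposeFst (fidelityOperator a b) x y := by
      rw [← hx]
      exact Finset.sum_congr rfl fun i _ => Finset.sum_comm
    simp only [Matrix.sub_apply, Matrix.smul_apply, Matrix.of_apply, Fintype.sum_prod_type,
      star_sub, sub_mul, mul_sub, Finset.sum_sub_distrib, hc, hc', hx, hx', Matrix.one_apply,
      smul_eq_mul]
    ring
  rw [e]
  exact h₁.smul (by norm_num [Complex.le_def])

-- The right-hand side is the sum `∑ C j k j k` of `le_teleportationDistance` for the teleportation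
-- channel, so this is where the fidelity becomes linear in the resource.
omit [DecidableEq A] [DecidableEq B] in
theorem trace_fidelityOperator_mul (σ : Matrix (A × B) (A × B) ℂ) :
    (fidelityOperator a b * σ).trace = ∑ j, ∑ k, ∑ i, ∑ x, ∑ y,
      a i j x.1 * b i j x.2 * σ x y * star (a i k y.1 * b i k y.2) := by
  symm
  calc _ = ∑ i, ∑ j, ∑ k, ∑ x, ∑ y,
        a i j x.1 * b i j x.2 * σ x y * star (a i k y.1 * b i k y.2) :=
        (Finset.sum_congr rfl fun j _ => Finset.sum_comm).trans Finset.sum_comm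
    _ = ∑ i, ∑ x, ∑ y, ∑ j, ∑ k,
        a i j x.1 * b i j x.2 * σ x y * star (a i k y.1 * b i k y.2) :=
        Finset.sum_congr rfl fun i _ =>
          ((Finset.sum_congr rfl fun j _ => Finset.sum_comm).trans Finset.sum_comm).trans
            (Finset.sum_congr rfl fun x _ =>
              (Finset.sum_congr rfl fun j _ => Finset.sum_comm).trans Finset.sum_comm)
    _ = ∑ x, ∑ y, ∑ i, ∑ j, ∑ k,
        a i j x.1 * b i j x.2 * σ x y * star (a i k y.1 * b i k y.2) :=
        Finset.sum_comm.trans (Finset.sum_congr rfl fun x _ => Finset.sum_comm)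
    _ = _ := by
      rw [Matrix.trace_mul_comm]
      simp only [Matrix.trace, Matrix.diag, Matrix.mul_apply, fidelityOperator, Matrix.of_apply,
        Finset.mul_sum]
      refine Finset.sum_congr rfl fun x _ => Finset.sum_congr rfl fun y _ =>
        Finset.sum_congr rfl fun i _ => Finset.sum_congr rfl fun j _ => ?_
      rw [star_sum, Finset.sum_mul, Finset.mul_sum]
      exact Finset.sum_congr rfl fun k _ => by ring

end Bipartite

open scoped MatrixOrder Matrix.Norms.L2Operator in
theorem re_trace_mul_nonneg {X : Type} [Fintype X] [DecidableEq X] {M ρ : Matrix X X ℂ}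
    (hM : M.PosSemidef) (hρ : ρ.PosSemidef) : 0 ≤ (M * ρ).trace.re := by
  obtain ⟨R, rfl⟩ := CStarAlgebra.nonneg_iff_eq_star_mul_self.1 hρ.nonneg
  rw [← Matrix.mul_assoc, Matrix.trace_mul_comm, ← Matrix.mul_assoc]
  exact (Complex.le_def.1 (hM.mul_mul_conjTranspose_same R).trace_nonneg).1

/-! ### Partial transposition, witnesses and groups of parties -/

section Parties

variable {k : ℕ} {d : Fin k → ℕ}

/-- Full transposition preserves positivity, so a decomposition with respect to `S` is as good as
one with respect to its complement. -/
theorem partialTranspose_compl_transpose (S : Finset (Fin k)) (Q : Op d) :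
    partialTranspose Sᶜ Qᵀ = partialTranspose S Q := by
  ext x y
  simp only [partialTranspose, Matrix.of_apply, Matrix.transpose_apply, Finset.mem_compl, ite_not]

theorem isDecomposable_partialTranspose {𝒞 : Finset (Finset (Fin k))} {S : Finset (Fin k)}
    (hS : S ∈ 𝒞) {Q : Op d} (hQ : Q.PosSemidef) : IsDecomposable 𝒞 (partialTranspose S Q) := by
  refine ⟨0, fun T => if T = S then Q else 0, .zero, fun T => ?_, ?_⟩
  · dsimp only
    split_ifs
    exacts [hQ, .zero]
  · rw [Finset.sum_eq_single S (fun T _ hT => ?_) (fun h => absurd hS h)]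
    · simp
    · ext x y
      simp [partialTranspose, hT]

/-- Exchanges the coordinates of a pair of basis states at the parties in `S`. -/
def exchange (S : Finset (Fin k)) : Equiv.Perm (Basis d × Basis d) :=
  Function.Involutive.toPerm
    (fun p => (fun i => if i ∈ S then p.2 i else p.1 i, fun i => if i ∈ S then p.1 i else p.2 i))
    (fun p => by
      ext i <;> simp only <;> split_ifs <;> rfl)

theorem exchange_apply (S : Finset (Fin k)) (p : Basis d × Basis d) :
    exchange S p =
      (fun i => if i ∈ S then p.2 i else p.1 i, fun i => if i ∈ S then p.1 i else p.2 i) := rfl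

/-- On a product vector, partial transposition can be moved to the vector: it conjugates the factors
in `S` and leaves a product vector. -/
theorem re_partialTranspose_productVector_nonneg (S : Finset (Fin k)) {Q : Op d}
    (hQ : Q.PosSemidef) (ψ : ∀ i : Fin k, Fin (d i) → ℂ) :
    0 ≤ (star (productVector ψ) ⬝ᵥ (partialTranspose S Q *ᵥ productVector ψ)).re := by
  set ψ' : ∀ i : Fin k, Fin (d i) → ℂ := fun i => if i ∈ S then star (ψ i) else ψ i with hψ'
  have h : star (productVector ψ) ⬝ᵥ (partialTranspose S Q *ᵥ productVector ψ) =
      star (productVector ψ') ⬝ᵥ (Q *ᵥ productVector ψ') := by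
    simp only [dotProduct, Matrix.mulVec, Finset.mul_sum, ← Fintype.sum_prod_type']
    refine Fintype.sum_equiv (exchange S) _ _ fun p => ?_
    have hp : star (productVector ψ p.1) * productVector ψ p.2 =
        star (productVector ψ' (exchange S p).1) * productVector ψ' (exchange S p).2 := by
      simp only [productVector, star_prod, ← Finset.prod_mul_distrib]
      refine Finset.prod_congr rfl fun i _ => ?_
      simp only [hψ', exchange_apply]
      split_ifs
      · simp [mul_comm]
      · rfl
    have hq : partialTranspose S Q p.1 p.2 = Q (exchange S p).1 (exchange S p).2 := rfl
    rw [hq, Pi.star_apply, Pi.star_apply]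
    linear_combination Q (exchange S p).1 (exchange S p).2 * hp
  rw [h]
  exact (Complex.le_def.1 (hQ.dotProduct_mulVec_nonneg _)).1

/-- The identification of the basis of all parties with that of the two groups. -/
abbrev splitEquiv (d : Fin k → ℕ) (S : Finset (Fin k)) : Basis d ≃ GroupIn d S × GroupOut d S :=
  Equiv.piEquivPiSubtypeProd (· ∈ S) fun i => Fin (d i)

theorem partialTranspose_submatrix (S : Finset (Fin k))
    (M : Matrix (GroupIn d S × GroupOut d S) (GroupIn d S × GroupOut d S) ℂ) :
    partialTranspose S (M.submatrix (splitEquiv d S) (splitEquiv d S)) =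
      (transposeFst M).submatrix (splitEquiv d S) (splitEquiv d S) := by
  ext x y
  simp only [partialTranspose, transposeFst, Matrix.of_apply, Matrix.submatrix_apply]
  congr 1 <;> ext i <;> simp [i.2]

theorem trace_submatrix_mul (S : Finset (Fin k)) (ρ : Op d)
    (M : Matrix (GroupIn d S × GroupOut d S) (GroupIn d S × GroupOut d S) ℂ) :
    (M.submatrix (splitEquiv d S) (splitEquiv d S) * ρ).trace = (M * split S ρ).trace := by
  have h : ρ = (split S ρ).submatrix (splitEquiv d S) (splitEquiv d S) := by
    rw [split, Matrix.submatrix_submatrix, Equiv.symm_comp_self, Matrix.submatrix_id_id]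
  conv_lhs => rw [h]
  rw [Matrix.submatrix_mul_equiv]
  exact (splitEquiv d S).sum_comp fun x => (M * split S ρ) x x

/-- The constraint `W ≥ -n` bounds the expectation values below; without a lower bound the real
`sInf` would be the default value 0. -/
theorem bddBelow_feasible (𝒞 : Finset (Finset (Fin k))) (n m : ℝ) {ρ : Op d}
    (hρ : IsState ρ) :
    BddBelow ((fun W : Op d => (W * ρ).trace.re) '' feasible d 𝒞 n m) := by
  refine ⟨-n, ?_⟩
  rintro _ ⟨W, hW, rfl⟩
  have h := re_trace_mul_nonneg hW.2.2.1 hρ.posSemidef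
  rw [Matrix.add_mul, Matrix.trace_add, Matrix.smul_mul, Matrix.one_mul, Matrix.trace_smul,
    hρ.trace_eq_one] at h
  simp at h ⊢
  linarith

theorem neg_trace_le_witnessedPPT {𝒞 : Finset (Finset (Fin k))} {n m : ℝ} {ρ W : Op d}
    (hρ : IsState ρ) (hW : W ∈ feasible d 𝒞 n m) :
    -(W * ρ).trace.re ≤ witnessedPPT 𝒞 n m ρ :=
  (neg_le_neg (csInf_le (bddBelow_feasible 𝒞 n m hρ) ⟨W, hW, rfl⟩)).trans (le_max_right _ _)

end Parties

/-! ### The witness of a protocol and the final bound -/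

/-- There is an LOCC protocol with trivial output for Alice: both parties discard their systems
and Bob prepares a fixed state. -/
theorem exists_isLOCC (α β δ : Type) [Fintype α] [DecidableEq α] [Fintype β] [DecidableEq β]
    [Fintype δ] [DecidableEq δ] (s : δ) :
    ∃ Φ : Matrix (α × β) (α × β) ℂ → Matrix (Unit × δ) (Unit × δ) ℂ, IsLOCC α β Φ := by
  -- Each party measures in its basis: Alice's Kraus operators are `⟨i|`, Bob's are `|s⟩⟨i|`.
  refine ⟨_, IsLOCC.alice α β α (fun _ => Unit) (fun i => Matrix.of fun _ q => if q = i then 1 else 0)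
    ?_ _ fun _ => IsLOCC.bob Unit β β (fun _ => δ)
      (fun i => Matrix.of fun t q => if t = s ∧ q = i then 1 else 0) ?_ _ fun _ => IsLOCC.done⟩
  · ext p q
    simp [Matrix.sum_apply, Matrix.mul_apply, Matrix.one_apply, eq_comm]
  · ext p q
    simp [Matrix.sum_apply, Matrix.mul_apply, Matrix.one_apply, ite_and, eq_comm]

section Main

variable {k : ℕ} {d : Fin k → ℕ}

/-- The witness `1 - M / D` is the `S`-partial transpose of `Q = 1 - M^{T_S} / D`, which is positive
by the swap inequality. -/
theorem mem_feasible_of_isComplete {S : Finset (Fin k)} {𝒞 : Finset (Finset (Fin k))}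
    (h𝒞 : S ∈ 𝒞 ∨ Sᶜ ∈ 𝒞) {D : ℕ} [NeZero D] {n : ℝ} (hn : (D : ℝ) ≤ n) {I : Type} [Fintype I]
    {a : I → Fin D → GroupIn d S → ℂ} {b : I → Fin D → GroupOut d S → ℂ} (h : IsComplete a b) :
    (1 - (D : ℂ)⁻¹ • fidelityOperator a b).submatrix (splitEquiv d S) (splitEquiv d S) ∈
      feasible d 𝒞 n 1 := by
  have hD : (D : ℂ) ≠ 0 := Nat.cast_ne_zero.2 (NeZero.ne D)
  have hDinv : (0 : ℂ) ≤ (D : ℂ)⁻¹ := by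
    rw [← Complex.ofReal_natCast, ← Complex.ofReal_inv, Complex.zero_le_real]
    positivity
  set Q : Op d := (1 - (D : ℂ)⁻¹ • transposeFst (fidelityOperator a b)).submatrix
    (splitEquiv d S) (splitEquiv d S)
  have hQ : Q.PosSemidef := by
    refine Matrix.PosSemidef.submatrix ?_ _
    have e : (1 - (D : ℂ)⁻¹ • transposeFst (fidelityOperator a b)) =
        (D : ℂ)⁻¹ • ((D : ℂ) • 1 - transposeFst (fidelityOperator a b)) := by
      rw [smul_sub, smul_smul, inv_mul_cancel₀ hD, one_smul]
    rw [e]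
    exact h.posSemidef_sub_transposeFst.smul hDinv
  set W : Op d := (1 - (D : ℂ)⁻¹ • fidelityOperator a b).submatrix
    (splitEquiv d S) (splitEquiv d S)
  have hW : W = partialTranspose S Q := by
    rw [partialTranspose_submatrix]
    rw [transposeFst_one_sub_smul]
  have hWM : W = 1 - (D : ℂ)⁻¹ • (fidelityOperator a b).submatrix
      (splitEquiv d S) (splitEquiv d S) := by
    ext x y
    simp only [W, Matrix.submatrix_apply, Matrix.sub_apply, Matrix.smul_apply, Matrix.one_apply,
      EmbeddingLike.apply_eq_iff_eq]
  have hM := (posSemidef_fidelityOperator a b).submatrix (splitEquiv d S)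
  refine ⟨⟨?_, fun ψ => ?_⟩, ?_, ?_, ?_⟩
  · rw [hWM]
    exact Matrix.isHermitian_one.sub (hM.smul hDinv).isHermitian
  · rw [hW]
    exact re_partialTranspose_productVector_nonneg S hQ ψ
  · rw [hW]
    rcases h𝒞 with h𝒞 | h𝒞
    · exact isDecomposable_partialTranspose h𝒞 hQ
    · rw [← partialTranspose_compl_transpose]
      exact isDecomposable_partialTranspose h𝒞 hQ.transpose
  -- The lower bound combines `M ≤ D²` with `n ≥ D`, which makes `1 + n - D` nonnegative.
  · have e : W + (n : ℂ) • (1 : Op d) = ((1 + n - D : ℝ) : ℂ) • (1 : Op d) +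
        (D : ℂ)⁻¹ • (((D : ℂ) ^ 2) • (1 : Matrix (GroupIn d S × GroupOut d S) _ ℂ) -
          fidelityOperator a b).submatrix (splitEquiv d S) (splitEquiv d S) := by
      rw [hWM]
      ext x y
      simp only [Matrix.add_apply, Matrix.sub_apply, Matrix.smul_apply, Matrix.submatrix_apply,
        Matrix.one_apply, EmbeddingLike.apply_eq_iff_eq, smul_eq_mul]
      push_cast
      field_simp
      ring
    rw [e]
    refine (Matrix.PosSemidef.one.smul ?_).add
      ((h.posSemidef_sub_fidelityOperator.submatrix _).smul hDinv)
    rw [Complex.zero_le_real]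
    linarith
  · rw [hWM, Complex.ofReal_one, one_smul, sub_sub_cancel]
    exact hM.smul hDinv

theorem le_minTeleportationDistance {ρ : Op d} (hρ : IsState ρ) {S : Finset (Fin k)}
    {𝒞 : Finset (Finset (Fin k))} (h𝒞 : S ∈ 𝒞 ∨ Sᶜ ∈ 𝒞) {D : ℕ} [NeZero D] {n : ℝ}
    (hn : (D : ℝ) ≤ n) :
    2 * (D : ℝ) / (D + 1) * (1 - (1 + witnessedPPT 𝒞 n 1 ρ) / D) ≤
      minTeleportationDistance D (split S ρ) := by
  have hσ : (split S ρ).trace = 1 := by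
    rw [← hρ.trace_eq_one]
    exact (splitEquiv d S).symm.sum_comp fun x => ρ x x
  have hD : (0 : ℝ) < D := Nat.cast_pos.2 (NeZero.pos D)
  -- Some protocol must exist, since the real infimum of the empty set is 0.
  refine le_csInf ?_ ?_
  · obtain ⟨Φ, hΦ⟩ := exists_isLOCC (Fin D × GroupIn d S) (GroupOut d S) (Fin D) 0
    exact ⟨_, Φ, hΦ, rfl⟩
  · rintro _ ⟨Φ, hΦ, rfl⟩
    obtain ⟨I, hI, a, b, hΛ, hab⟩ := hΦ.exists_amplitudes
    have h₁ := le_teleportationDistance _ (hΛ (split S ρ)) ?_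
    · refine le_trans ?_ h₁
      rw [← trace_fidelityOperator_mul]
      -- With `s = Tr(M σ)` this reads `s / D - 1 ≤ E`.
      have h₂ := neg_trace_le_witnessedPPT hρ (mem_feasible_of_isComplete h𝒞 hn hab)
      rw [trace_submatrix_mul, Matrix.sub_mul, Matrix.one_mul, Matrix.smul_mul, Matrix.trace_sub,
        Matrix.trace_smul, hσ] at h₂
      set s := (fidelityOperator a b * split S ρ).trace
      have h₃ : (1 - (D : ℂ)⁻¹ • s).re = 1 - s.re / D := by
        rw [smul_eq_mul, mul_comm, ← div_eq_mul_inv, Complex.sub_re, Complex.div_natCast_re,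
          Complex.one_re]
      rw [h₃] at h₂
      refine mul_le_mul_of_nonneg_left ?_ (by positivity)
      have h₄ : s.re / (D : ℝ) ^ 2 = s.re / D / D := by rw [sq, div_div]
      rw [h₄]
      have h₅ : s.re / D / D ≤ (1 + witnessedPPT 𝒞 n 1 ρ) / D :=
        div_le_div_of_nonneg_right (by linarith) hD.le
      linarith
    -- Trace preservation of the channel: Kraus completeness together with unit trace of the
    -- resource.
    · intro j j'
      calc _ = ∑ i, ∑ l, ∑ x, ∑ y, split S ρ x y *
            (star (a i j' y.1 * b i l y.2) * (a i j x.1 * b i l x.2)) := by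
              rw [Finset.sum_comm]
              refine Finset.sum_congr rfl fun i _ => Finset.sum_congr rfl fun l _ =>
                Finset.sum_congr rfl fun x _ => Finset.sum_congr rfl fun y _ => ?_
              ring
        _ = ∑ i, ∑ x, ∑ y, ∑ l, split S ρ x y *
            (star (a i j' y.1 * b i l y.2) * (a i j x.1 * b i l x.2)) :=
              Finset.sum_congr rfl fun i _ =>
                Finset.sum_comm.trans (Finset.sum_congr rfl fun x _ => Finset.sum_comm)
        _ = ∑ x, ∑ y, ∑ i, ∑ l, split S ρ x y *
            (star (a i j' y.1 * b i l y.2) * (a i j x.1 * b i l x.2)) :=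
              Finset.sum_comm.trans (Finset.sum_congr rfl fun x _ => Finset.sum_comm)
        _ = ∑ x, ∑ y, split S ρ x y * if j' = j ∧ y = x then 1 else 0 := by
              simp_rw [← Finset.mul_sum, hab]
        _ = if j = j' then 1 else 0 := by
              by_cases hj : j = j'
              · simpa [hj, Matrix.trace] using hσ
              · simp [hj, Ne.symm hj]

end Main

end WitnessedEntanglement

end

theorem proposition7 {k : ℕ} (d : Fin k → ℕ) (ρ : WitnessedEntanglement.Op d)
    (hρ : WitnessedEntanglement.IsState ρ)
    (S : Finset (Fin k)) (hS : S.Nonempty) (hS' : Sᶜ.Nonempty)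
    (D : ℕ) (hD : D = WitnessedEntanglement.splitDim d S) (n : ℝ) (hn : (D : ℝ) ≤ n) :
    2 * (D : ℝ) / (D + 1) *
        (1 - (1 + WitnessedEntanglement.witnessedPPT
          (WitnessedEntanglement.allGroups k) n 1 ρ) / D) ≤
      WitnessedEntanglement.minTeleportationDistance D (WitnessedEntanglement.split S ρ) ∧
    (S.card = 1 ∨ Sᶜ.card = 1 →
      2 * (D : ℝ) / (D + 1) *
          (1 - (1 + WitnessedEntanglement.witnessedPPT
            (WitnessedEntanglement.singleParties k) n 1 ρ) / D) ≤
        WitnessedEntanglement.minTeleportationDistance D (WitnessedEntanglement.split S ρ)) := by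
  -- Unit trace rules out an empty product basis, so every `d i`, and hence `D`, is positive.
  have hne : Nonempty (WitnessedEntanglement.Basis d) := by
    by_contra h
    rw [not_nonempty_iff] at h
    have := hρ.trace_eq_one
    simp [Matrix.trace] at this
  obtain ⟨x⟩ := hne
  have hd : ∀ i, 0 < d i := fun i => (x i).pos
  have : NeZero D := by
    refine ⟨Nat.pos_iff_ne_zero.1 ?_⟩
    rw [hD, WitnessedEntanglement.splitDim]
    exact lt_min (Finset.prod_pos fun i _ => hd i) (Finset.prod_pos fun i _ => hd i)
  have hsingle : ∀ T : Finset (Fin k), T.card = 1 → T ∈ WitnessedEntanglement.singleParties k := by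
    intro T hT
    obtain ⟨i, rfl⟩ := Finset.card_eq_one.1 hT
    exact Finset.mem_image_of_mem _ (Finset.mem_univ i)
  exact ⟨WitnessedEntanglement.le_minTeleportationDistance hρ (.inl (Finset.mem_univ S)) hn,
    fun h => WitnessedEntanglement.le_minTeleportationDistance hρ
      (h.imp (hsingle S) (hsingle Sᶜ)) hn⟩
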